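/- Let $\mathbb{D}=\{z\in\mathbb{C}:|z|<1\}$ and let $X=X_1\times\dots\times X_n\subset\mathbb{C}^n$, $n\ge 1$, where each $X_i\subset\mathbb{C}$ is a Jordan domain, i.e. a bounded simply connected domain whose boundary is a Jordan curve. Let $p\in X$, let $m\ge 0$ be a real number, and put $\alpha=m\,\chi_{\{p\}}$. For a holomorphic map $f:\mathbb{D}\to X$ (an analytic disc in $X$ centred at $f(0)$) let $$H^L_\alpha(f)=\sum_{a\in\mathbb{D}}\alpha(f(a))\,m_a\log|a|\in[-\infty,0],$$ where $m_a\in\{1,2,\dots,\infty\}$ is the order of vanishing of $f-f(a)$ at $a$ and $\log 0=-\infty$, $0\cdot\infty=0\cdot(-\infty)=0$; and for $x\in X$ let $$EH^L_\alpha(x)=\inf\{H^L_\alpha(f): f:\mathbb{D}\to X\text{ holomorphic},\ f(0)=x\}.$$ Then for every $x\in X$ the infimum is attained: there is a holomorphic $f:\mathbb{D}\to X$ with $f(0)=x$ and $$EH^L_\alpha(x)=H^L_\alpha(f)=\sum_{a\in\mathbb{D}}\alpha(f(a))\,m_a\log|a|.$$ Moreover $f$ can be chosen of the following form. There are Riemann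 maps (biholomorphic maps) $F_i:\mathbb{D}\to X_i$, automorphisms $\psi_i$ of $\mathbb{D}$ with $F_i(\psi_i(0))=x_i$, points $z_i\in\mathbb{D}$ with $F_i(\psi_i(z_i))=p_i$, an index $j$ with $|z_j|=\max_i|z_i|$, and numbers $c_i\in\mathbb{C}$ with $|c_i|\le 1$, $c_j=1$ and $c_iz_j=z_i$ (thus $c_i=z_i/z_j$ if $z_j\ne 0$, i.e. if $x\neq p$), such that $$f(w)=\bigl(F_1(\psi_1(c_1w)),\dots,F_n(\psi_n(c_nw))\bigr),\qquad w\in\mathbb{D}.$$ -/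

import Mathlib

open scoped ENNReal

noncomputable section

namespace LelongDisc

/-- The open unit disc in the complex plane. -/
def unitDisc : Set ℂ := Metric.ball (0 : ℂ) 1

/-- A Jordan curve in the plane: the image of the circle under a continuous injective map. -/
def IsJordanCurve (J : Set ℂ) : Prop :=
  ∃ γ : Circle → ℂ, Continuous γ ∧ Function.Injective γ ∧ Set.range γ = J

/-- A Jordan domain: a bounded simply connected domain in the plane whose boundary is a
Jordan curve. (Non-emptiness and connectedness are part of `IsSimplyConnected`.) -/
structure IsJordanDomain (U : Set ℂ) : Prop where
  isOpen : IsOpen U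
  isBounded : Bornology.IsBounded U
  isSimplyConnected : IsSimplyConnected U
  isJordanCurve_frontier : IsJordanCurve (frontier U)

/-- `F` maps the plane open set `U` biholomorphically onto `V`: it is a holomorphic bijection
(the inverse of a holomorphic bijection of plane open sets is holomorphic). For `U` the unit disc
these are the Riemann maps of `V`; for `U = V` they are the automorphisms of `U`. -/
def IsBiholomorphicOn (F : ℂ → ℂ) (U V : Set ℂ) : Prop :=
  DifferentiableOn ℂ F U ∧ Set.BijOn F U V

/-- `f` is an analytic disc in `X`, a holomorphic map from the unit disc to `X`.
Values of `f` outside the unit disc are irrelevant. -/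
def IsAnalyticDisc {n : ℕ} (X : Set (Fin n → ℂ)) (f : ℂ → Fin n → ℂ) : Prop :=
  DifferentiableOn ℂ f unitDisc ∧ Set.MapsTo f unitDisc X

/-- The multiplicity of `f` at `a`: the order of vanishing of `f - f a` at `a`
(equal to `⊤` if `f` is constant near `a`). -/
def discMultiplicity {n : ℕ} (f : ℂ → Fin n → ℂ) (a : ℂ) : ℕ∞ :=
  analyticOrderAt (fun z => f z - f a) a

/-- The Lelong functional `H_α^L (f) = ∑_{|a| < 1} α (f a) * m_a * log |a|`, with values in the
extended reals, where `log 0 = -∞` and `0 * ±∞ = 0`. For `α ≥ 0` all the terms are nonpositive,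
so that the sum always exists in the extended reals. -/
def lelongFunctional {n : ℕ} (α : (Fin n → ℂ) → ℝ) (f : ℂ → Fin n → ℂ) : EReal :=
  ∑' a : unitDisc, (α (f a) : EReal) * (((discMultiplicity f a : ℕ∞) : ℝ≥0∞) : EReal) *
    ENNReal.log ‖(a : ℂ)‖ₑ

/-- The envelope `EH_α^L (x)`: the infimum of the Lelong functional over all analytic discs in `X`
centred at `x`. -/
def lelongEnvelope {n : ℕ} (X : Set (Fin n → ℂ)) (α : (Fin n → ℂ) → ℝ) (x : Fin n → ℂ) : EReal :=
  ⨅ (f : ℂ → Fin n → ℂ) (_ : IsAnalyticDisc X f) (_ : f 0 = x), lelongFunctional α f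

end LelongDisc

end

namespace LelongDisc

open Metric Set Filter Topology ComplexConjugate

/-! Let `G i` be the Riemann map of `X i` with `G i (x i) = 0`, `F i` its inverse, `q i = G i (p
i)`, and let `j` maximise `‖q i‖`. Both bounds equal `m * log ‖q j‖`.

Lower bound, for `q j ≠ 0`: given a disc `g` centred at `x`, the function `b = moebius (q j) ∘ G j ∘
g_j` maps the disc to itself, has `‖b 0‖ = ‖q j‖`, and vanishes at each `a` with `g a = p` to order
at least the multiplicity of `g` there. Dividing out Blaschke factors gives `‖q j‖ ≤ ∏ ‖a‖ ^ m_a`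
(`norm_apply_zero_le_prod_norm_zeros`); logarithms give `mul_log_le_lelongFunctional`.

Attainment: `f w = (F i (c i * w))_i` with `c i * q j = q i` meets `p` only at `w = q j`, with
multiplicity one, since `G j` inverts its `j`-th coordinate. Maximality of `‖q j‖` makes `‖c i‖ ≤
1`, so `f` stays in `X`.

The Riemann maps come from Koebe's extremal problem: maximise `‖deriv f p‖`, using Montel and
Hurwitz for existence and a square root for surjectivity. -/

/-! ### Möbius automorphisms of the unit disc -/

/-- The automorphism of the unit disc that sends `a` to `0`. -/
noncomputable def moebius (a z : ℂ) : ℂ := (z - a) / (1 - conj a * z)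

@[simp] theorem moebius_self (a : ℂ) : moebius a a = 0 := by simp [moebius]

@[simp] theorem moebius_zero_right (a : ℂ) : moebius a 0 = -a := by simp [moebius]

theorem moebius_denom_ne_zero {a z : ℂ} (ha : a ∈ ball (0 : ℂ) 1) (hz : z ∈ ball (0 : ℂ) 1) :
    1 - conj a * z ≠ 0 := by
  rw [mem_ball_zero_iff] at ha hz
  intro h
  have h1 : ‖conj a * z‖ = 1 := by rw [← sub_eq_zero.1 h, norm_one]
  rw [norm_mul, Complex.norm_conj] at h1
  nlinarith [norm_nonneg a, norm_nonneg z]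

theorem moebius_eq_zero_iff {a z : ℂ} (ha : a ∈ ball (0 : ℂ) 1) (hz : z ∈ ball (0 : ℂ) 1) :
    moebius a z = 0 ↔ z = a := by
  simp [moebius, moebius_denom_ne_zero ha hz, sub_eq_zero]

theorem moebius_mapsTo {a : ℂ} (ha : a ∈ ball (0 : ℂ) 1) :
    MapsTo (moebius a) (ball 0 1) (ball 0 1) := by
  intro z hz
  have hd := moebius_denom_ne_zero ha hz
  rw [mem_ball_zero_iff] at ha hz ⊢
  rw [moebius, norm_div, div_lt_one (norm_pos_iff.2 hd),
    ← sq_lt_sq₀ (norm_nonneg _) (norm_nonneg _)]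
  have h1 : ‖a‖ ^ 2 < 1 := by nlinarith [norm_nonneg a]
  have h2 : ‖z‖ ^ 2 < 1 := by nlinarith [norm_nonneg z]
  have key := mul_pos (sub_pos.2 h1) (sub_pos.2 h2)
  rw [Complex.sq_norm, Complex.sq_norm, Complex.normSq_apply, Complex.normSq_apply] at *
  simp only [Complex.sub_re, Complex.sub_im, Complex.mul_re, Complex.mul_im, Complex.conj_re,
    Complex.conj_im, Complex.one_re, Complex.one_im]
  nlinarith

theorem moebius_neg_moebius {a z : ℂ} (ha : a ∈ ball (0 : ℂ) 1) (hz : z ∈ ball (0 : ℂ) 1) :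
    moebius (-a) (moebius a z) = z := by
  have hd := moebius_denom_ne_zero ha hz
  have hd' := moebius_denom_ne_zero ha ha
  have e1 : (z - a) / (1 - conj a * z) + a = z * (1 - conj a * a) / (1 - conj a * z) := by
    rw [div_add' _ _ _ hd]; ring
  have e2 : 1 + conj a * ((z - a) / (1 - conj a * z)) = (1 - conj a * a) / (1 - conj a * z) := by
    field_simp; ring
  simp only [moebius, map_neg, sub_neg_eq_add, neg_mul]
  rw [e1, e2, div_div_div_cancel_right₀ hd, mul_div_assoc, div_self hd', mul_one]

theorem moebius_injOn {a : ℂ} (ha : a ∈ ball (0 : ℂ) 1) : InjOn (moebius a) (ball 0 1) := by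
  intro z hz w hw h
  rw [← moebius_neg_moebius ha hz, h, moebius_neg_moebius ha hw]

theorem neg_mem_unitBall {a : ℂ} (ha : a ∈ ball (0 : ℂ) 1) : -a ∈ ball (0 : ℂ) 1 := by
  simpa using ha

theorem hasDerivAt_moebius {a z : ℂ} (ha : a ∈ ball (0 : ℂ) 1) (hz : z ∈ ball (0 : ℂ) 1) :
    HasDerivAt (moebius a) ((1 - conj a * a) / (1 - conj a * z) ^ 2) z := by
  have hd := moebius_denom_ne_zero ha hz
  have h1 : HasDerivAt (fun z : ℂ => z - a) 1 z := (hasDerivAt_id z).sub_const a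
  have h2 : HasDerivAt (fun z : ℂ => 1 - conj a * z) (-(conj a * 1)) z :=
    ((hasDerivAt_id z).const_mul (conj a)).const_sub 1
  refine (h1.div h2 hd).congr_deriv ?_
  congr 1
  ring

theorem deriv_moebius_ne_zero {a z : ℂ} (ha : a ∈ ball (0 : ℂ) 1) (hz : z ∈ ball (0 : ℂ) 1) :
    deriv (moebius a) z ≠ 0 := by
  rw [(hasDerivAt_moebius ha hz).deriv]
  exact div_ne_zero (moebius_denom_ne_zero ha ha) (pow_ne_zero _ (moebius_denom_ne_zero ha hz))

theorem differentiableOn_moebius {a : ℂ} (ha : a ∈ ball (0 : ℂ) 1) :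
    DifferentiableOn ℂ (moebius a) (ball 0 1) := fun _ hz =>
  (hasDerivAt_moebius ha hz).differentiableAt.differentiableWithinAt

/-! ### Dividing a bounded holomorphic function by Blaschke factors -/

/-- Moving `a` to the origin reduces this to the Schwarz lemma: the quotient is a `dslope` at `0`,
and the bound 1 survives the division. -/
theorem exists_eq_moebius_mul {b : ℂ → ℂ} {a : ℂ} (hb : DifferentiableOn ℂ b (ball 0 1))
    (hb1 : ∀ z ∈ ball (0 : ℂ) 1, ‖b z‖ ≤ 1) (ha : a ∈ ball (0 : ℂ) 1) (hba : b a = 0) :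
    ∃ b' : ℂ → ℂ, DifferentiableOn ℂ b' (ball 0 1) ∧ (∀ z ∈ ball (0 : ℂ) 1, ‖b' z‖ ≤ 1) ∧
      ∀ z ∈ ball (0 : ℂ) 1, b z = moebius a z * b' z := by
  have hna := neg_mem_unitBall ha
  set g : ℂ → ℂ := b ∘ moebius (-a)
  have hg : DifferentiableOn ℂ g (ball 0 1) :=
    hb.comp (differentiableOn_moebius hna) (moebius_mapsTo hna)
  have hg0 : g 0 = 0 := by simp [g, hba]
  have hgm : MapsTo g (ball 0 1) (closedBall (g 0) 1) := fun z hz => by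
    rw [hg0, mem_closedBall_zero_iff]
    exact hb1 _ (moebius_mapsTo hna hz)
  refine ⟨fun z => dslope g 0 (moebius a z), ?_, fun z hz => ?_, fun z hz => ?_⟩
  · exact ((Complex.differentiableOn_dslope (ball_mem_nhds 0 one_pos)).2 hg).comp
      (differentiableOn_moebius ha) (moebius_mapsTo ha)
  · simpa using Complex.norm_dslope_le_div_of_mapsTo_ball hg hgm (moebius_mapsTo ha hz)
  · have := sub_smul_dslope g 0 (moebius a z)
    rw [hg0, sub_zero, sub_zero, smul_eq_mul] at this
    rw [this]
    simp [g, moebius_neg_moebius ha hz]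

theorem analyticAt_of_differentiableOn_unitBall {E : Type*} [NormedAddCommGroup E]
    [NormedSpace ℂ E] [CompleteSpace E] {b : ℂ → E} (hb : DifferentiableOn ℂ b (ball 0 1))
    {z : ℂ} (hz : z ∈ ball (0 : ℂ) 1) : AnalyticAt ℂ b z :=
  hb.analyticAt (isOpen_ball.mem_nhds hz)

theorem analyticOrderAt_moebius_self {a : ℂ} (ha : a ∈ ball (0 : ℂ) 1) :
    analyticOrderAt (moebius a) a = 1 :=
  (analyticAt_of_differentiableOn_unitBall (differentiableOn_moebius ha)
    ha).analyticOrderAt_eq_one_of_zero_deriv_ne_zero (moebius_self a) (deriv_moebius_ne_zero ha ha)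

theorem exists_eq_moebius_pow_mul {a : ℂ} (ha : a ∈ ball (0 : ℂ) 1) (n : ℕ) {b : ℂ → ℂ}
    (hb : DifferentiableOn ℂ b (ball 0 1)) (hb1 : ∀ z ∈ ball (0 : ℂ) 1, ‖b z‖ ≤ 1)
    (hn : (n : ℕ∞) ≤ analyticOrderAt b a) :
    ∃ b' : ℂ → ℂ, DifferentiableOn ℂ b' (ball 0 1) ∧ (∀ z ∈ ball (0 : ℂ) 1, ‖b' z‖ ≤ 1) ∧
      ∀ z ∈ ball (0 : ℂ) 1, b z = moebius a z ^ n * b' z := by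
  induction n generalizing b with
  | zero => exact ⟨b, hb, hb1, fun z _ => by simp⟩
  | succ n ih =>
    have hba : b a = 0 := apply_eq_zero_of_analyticOrderAt_ne_zero fun h0 => by
      rw [h0] at hn; simp at hn
    obtain ⟨c, hc, hc1, hbc⟩ := exists_eq_moebius_mul hb hb1 ha hba
    have hord : analyticOrderAt b a = 1 + analyticOrderAt c a := by
      rw [← analyticOrderAt_moebius_self ha, ← analyticOrderAt_mul
        (analyticAt_of_differentiableOn_unitBall (differentiableOn_moebius ha) ha)
        (analyticAt_of_differentiableOn_unitBall hc ha)]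
      exact analyticOrderAt_congr (eventually_of_mem (isOpen_ball.mem_nhds ha) hbc)
    have hn' : (n : ℕ∞) ≤ analyticOrderAt c a := by
      rw [hord, Nat.cast_add, Nat.cast_one, add_comm] at hn
      exact (ENat.add_le_add_iff_left ENat.one_ne_top).1 hn
    obtain ⟨d, hd, hd1, hcd⟩ := ih hc hc1 hn'
    exact ⟨d, hd, hd1, fun z hz => by rw [hbc z hz, hcd z hz]; ring⟩

/-- A holomorphic function bounded by one on the unit disc is bounded at the origin by the
product of the moduli of its zeros. -/
theorem norm_apply_zero_le_prod_norm_zeros (S : Finset ℂ) (n : ℂ → ℕ) {b : ℂ → ℂ}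
    (hS : ∀ a ∈ S, a ∈ ball (0 : ℂ) 1) (hb : DifferentiableOn ℂ b (ball 0 1))
    (hb1 : ∀ z ∈ ball (0 : ℂ) 1, ‖b z‖ ≤ 1) (hn : ∀ a ∈ S, (n a : ℕ∞) ≤ analyticOrderAt b a) :
    ‖b 0‖ ≤ ∏ a ∈ S, ‖a‖ ^ n a := by
  induction S using Finset.induction_on generalizing b with
  | empty => simpa using hb1 0 (mem_ball_self one_pos)
  | insert a S haS ih =>
    have ha : a ∈ ball (0 : ℂ) 1 := hS a (Finset.mem_insert_self _ _)
    obtain ⟨c, hc, hc1, hbc⟩ :=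
      exists_eq_moebius_pow_mul ha (n a) hb hb1 (hn a (Finset.mem_insert_self _ _))
    have hSa : ∀ w ∈ S, w ∈ ball (0 : ℂ) 1 := fun w hw => hS w (Finset.mem_insert_of_mem hw)
    -- The factor at `a` has no zero at `w ≠ a`, so the quotient keeps the order of `b` at the
    -- remaining points.
    have hord : ∀ w ∈ S, (n w : ℕ∞) ≤ analyticOrderAt c w := fun w hw => by
      have hw1 := hSa w hw
      have hma := analyticAt_of_differentiableOn_unitBall (differentiableOn_moebius ha) hw1
      have h0 : analyticOrderAt (moebius a ^ n a) w = 0 := by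
        rw [(hma.pow _).analyticOrderAt_eq_zero, Pi.pow_apply]
        refine pow_ne_zero _ fun h => haS ?_
        rwa [← (moebius_eq_zero_iff ha hw1).1 h]
      have h1 : analyticOrderAt b w = analyticOrderAt (moebius a ^ n a * c) w :=
        analyticOrderAt_congr (eventually_of_mem (isOpen_ball.mem_nhds hw1) hbc)
      rw [analyticOrderAt_mul (hma.pow _) (analyticAt_of_differentiableOn_unitBall hc hw1), h0,
        zero_add] at h1
      exact h1 ▸ hn w (Finset.mem_insert_of_mem hw)
    rw [Finset.prod_insert haS, hbc 0 (mem_ball_self one_pos), norm_mul, norm_pow,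
      moebius_zero_right, norm_neg]
    exact mul_le_mul_of_nonneg_left (ih hSa hc hc1 hord) (by positivity)

/-! ### Normal families -/

/-- **Montel's theorem** for ultrafilters: along an ultrafilter, holomorphic functions bounded by
one converge locally uniformly. -/
theorem exists_tendstoLocallyUniformlyOn_of_norm_le_one {ι : Type*} {U : Set ℂ} (hU : IsOpen U)
    {F : ι → ℂ → ℂ} (l : Ultrafilter ι) (hF : ∀ i, DifferentiableOn ℂ (F i) U)
    (hF1 : ∀ i, ∀ z ∈ U, ‖F i z‖ ≤ 1) :
    ∃ g : ℂ → ℂ, TendstoLocallyUniformlyOn F g l U := by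
  -- Along an ultrafilter, compactness of the closed disc gives all pointwise limits at once, with
  -- no diagonal subsequence.
  have hlim : ∀ z ∈ U, ∃ y, Tendsto (fun i => F i z) l (𝓝 y) := fun z hz => by
    obtain ⟨y, -, hy⟩ := (isCompact_closedBall (0 : ℂ) 1).ultrafilter_le_nhds
      (l.map fun i => F i z) (le_principal_iff.2
        (Filter.mem_map.2 (Eventually.of_forall fun i => by simpa using hF1 i z hz)))
    exact ⟨y, hy⟩
  choose! g hg using hlim
  refine ⟨g, Metric.tendstoLocallyUniformlyOn_iff.2 fun ε hε c hc => ?_⟩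
  obtain ⟨r, hr, hrU⟩ := Metric.isOpen_iff.1 hU c hc
  -- Equicontinuity from the Schwarz lemma: values of `F i` differ by at most 2, so the constant `2
  -- / r` is independent of `i`.
  have hlip : ∀ i, ∀ z ∈ ball c r, dist (F i z) (F i c) ≤ 2 / r * dist z c := fun i z hz => by
    refine Complex.dist_le_div_mul_dist_of_mapsTo_ball ((hF i).mono hrU) (fun w hw => ?_) hz
    rw [mem_closedBall, dist_eq_norm]
    linarith [norm_sub_le (F i w) (F i c), hF1 i w (hrU hw), hF1 i c hc]
  set δ := min r (ε * r / 8)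
  have hδ : 0 < δ := lt_min hr (by positivity)
  have hsmall : ∀ i, ∀ z ∈ ball c δ, dist (F i z) (F i c) ≤ ε / 4 := fun i z hz => by
    refine (hlip i z (ball_subset_ball (min_le_left _ _) hz)).trans ?_
    have hz' : dist z c ≤ ε * r / 8 := (mem_ball.1 hz).le.trans (min_le_right _ _)
    calc 2 / r * dist z c ≤ 2 / r * (ε * r / 8) := by gcongr
      _ = ε / 4 := by field_simp; norm_num
  have hsmall' : ∀ z ∈ ball c δ, dist (g z) (g c) ≤ ε / 4 := fun z hz =>
    le_of_tendsto ((hg z (hrU (ball_subset_ball (min_le_left _ _) hz))).dist (hg c hc))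
      (Eventually.of_forall fun i => hsmall i z hz)
  refine ⟨ball c δ, mem_nhdsWithin_of_mem_nhds (ball_mem_nhds c hδ), ?_⟩
  filter_upwards [Metric.tendsto_nhds.1 (hg c hc) (ε / 4) (by positivity)] with i hi z hz
  have h1 := hsmall i z hz
  have h2 := hsmall' z hz
  have h3 := dist_triangle4 (g z) (g c) (F i c) (F i z)
  rw [dist_comm (g c) (F i c), dist_comm (F i c) (F i z)] at h3
  linarith

/-- A local form of **Hurwitz's theorem**: if zero-free holomorphic functions converge locally
uniformly, then every zero of the limit function is an interior point of its zero set. -/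
theorem eventually_eq_zero_of_tendstoLocallyUniformlyOn {ι : Type*} {l : Filter ι} [l.NeBot]
    {V : Set ℂ} (hV : IsOpen V) {F : ι → ℂ → ℂ} {g : ℂ → ℂ}
    (hF : ∀ i, DifferentiableOn ℂ (F i) V) (hF0 : ∀ i, ∀ z ∈ V, F i z ≠ 0)
    (hlim : TendstoLocallyUniformlyOn F g l V) {c : ℂ} (hc : c ∈ V) (hgc : g c = 0) :
    ∀ᶠ z in 𝓝 c, g z = 0 := by
  have hg : DifferentiableOn ℂ g V := hlim.differentiableOn (Eventually.of_forall hF) hV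
  refine ((hg.analyticAt (hV.mem_nhds hc)).eventually_eq_zero_or_eventually_ne_zero).resolve_right
    fun hne => ?_
  obtain ⟨ρ, hρ, hρV⟩ := Metric.isOpen_iff.1 hV c hc
  obtain ⟨σ, hσ, hσg⟩ := Metric.eventually_nhds_iff.1 (eventually_nhdsWithin_iff.1 hne)
  set r := min ρ σ / 2
  have hr : 0 < r := by have := lt_min hρ hσ; positivity
  have hrlt : r < min ρ σ := half_lt_self (lt_min hρ hσ)
  have hKV : closedBall c r ⊆ V :=
    (closedBall_subset_ball (hrlt.trans_le (min_le_left _ _))).trans hρV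
  have hsph : ∀ z ∈ sphere c r, g z ≠ 0 := fun z hz =>
    hσg (by rw [mem_sphere.1 hz]; exact hrlt.trans_le (min_le_right _ _))
      (ne_of_mem_sphere hz hr.ne')
  obtain ⟨w, hw, hwmin⟩ := (isCompact_sphere c r).exists_isMinOn
    (NormedSpace.sphere_nonempty.2 hr.le)
    ((hg.continuousOn.mono (sphere_subset_closedBall.trans hKV)).norm)
  set ε := ‖g w‖
  have hε : 0 < ε := norm_pos_iff.2 (hsph w hw)
  have hunif := (tendstoLocallyUniformlyOn_iff_forall_isCompact hV).1 hlim _ hKV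
    (isCompact_closedBall c r)
  obtain ⟨i, hi⟩ := (Metric.tendstoUniformlyOn_iff.1 hunif (ε / 4) (by positivity)).exists
  -- The maximum principle for `1 / F i` carries `‖F i‖ ≥ ε / 2` from the circle to `c`, while `F i
  -- c` is within `ε / 4` of `g c = 0`.
  have hbd : ∀ z ∈ frontier (ball c r), ‖(F i z)⁻¹‖ ≤ 2 / ε := fun z hz => by
    rw [frontier_ball c hr.ne'] at hz
    have h1 := hi z (sphere_subset_closedBall hz)
    have h2 : ε ≤ ‖g z‖ := hwmin hz
    rw [dist_eq_norm] at h1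
    have h3 := norm_sub_norm_le (g z) (F i z)
    rw [norm_inv, ← inv_div]
    exact inv_anti₀ (by positivity) (by linarith)
  have hdiff : DiffContOnCl ℂ (fun z => (F i z)⁻¹) (ball c r) := by
    refine DifferentiableOn.diffContOnCl ?_
    rw [closure_ball c hr.ne']
    exact ((hF i).mono hKV).inv fun z hz => hF0 i z (hKV hz)
  have h4 := Complex.norm_le_of_forall_mem_frontier_norm_le isBounded_ball hdiff hbd
    (subset_closure (mem_ball_self hr))
  have h5 := hi c (mem_closedBall_self hr.le)
  rw [hgc, dist_zero_left] at h5
  rw [norm_inv, ← inv_div] at h4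
  have h6 := (inv_le_inv₀ (norm_pos_iff.2 (hF0 i c hc)) (by positivity)).1 h4
  linarith

/-- If zero-free holomorphic functions on a connected open set converge locally uniformly, then
the limit function either vanishes identically or has no zeros. -/
theorem eqOn_zero_of_tendstoLocallyUniformlyOn {ι : Type*} {l : Filter ι} [l.NeBot]
    {U V : Set ℂ} (hU : IsOpen U) (hUc : IsPreconnected U) (hV : IsOpen V) (hVU : V ⊆ U)
    {F : ι → ℂ → ℂ} {g : ℂ → ℂ}
    (hF : ∀ i, DifferentiableOn ℂ (F i) U) (hF0 : ∀ i, ∀ z ∈ V, F i z ≠ 0)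
    (hlim : TendstoLocallyUniformlyOn F g l U) {c : ℂ} (hc : c ∈ V) (hgc : g c = 0) :
    EqOn g 0 U := by
  have hg : DifferentiableOn ℂ g U := hlim.differentiableOn (Eventually.of_forall hF) hU
  exact (hg.analyticOnNhd hU).eqOn_zero_of_preconnected_of_eventuallyEq_zero hUc (hVU hc)
    (eventually_eq_zero_of_tendstoLocallyUniformlyOn hV (fun i => (hF i).mono hVU) hF0
      (hlim.mono hVU) hc hgc)

/-! ### The Riemann mapping theorem for bounded domains -/

/-- The competitors in the extremal problem that the Riemann map of `U` solves: locally biholomorphic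
injective maps of `U` to the unit disc that vanish at `p`. -/
structure IsRiemannCompetitor (U : Set ℂ) (p : ℂ) (f : ℂ → ℂ) : Prop where
  differentiableOn : DifferentiableOn ℂ f U
  mapsTo : MapsTo f U (ball 0 1)
  injOn : InjOn f U
  deriv_ne_zero : ∀ z ∈ U, deriv f z ≠ 0
  apply_eq_zero : f p = 0

variable {U : Set ℂ} {p : ℂ}

theorem exists_isRiemannCompetitor (hU : Bornology.IsBounded U) :
    ∃ f, IsRiemannCompetitor U p f := by
  obtain ⟨R, hR, hUR⟩ := hU.subset_ball_lt 0 p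
  have hRc : (R : ℂ) ≠ 0 := by exact_mod_cast hR.ne'
  have hd : ∀ z, HasDerivAt (fun z : ℂ => (z - p) / R) (1 / R) z := fun z =>
    ((hasDerivAt_id z).sub_const p).div_const _
  refine ⟨fun z => (z - p) / R, fun z _ => (hd z).differentiableAt.differentiableWithinAt,
    fun z hz => ?_, fun z _ w _ h => ?_, fun z _ => ?_, by simp⟩
  · have := hUR hz
    rw [mem_ball, dist_eq_norm] at this
    rw [mem_ball_zero_iff, norm_div, Complex.norm_real, Real.norm_of_nonneg hR.le,
      div_lt_one hR]
    exact this
  · simpa [div_left_inj' hRc] using h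
  · rw [(hd z).deriv]
    exact one_div_ne_zero hRc

theorem exists_norm_deriv_le_of_mapsTo_unitBall (hU : IsOpen U) (hp : p ∈ U) :
    ∃ C : ℝ, ∀ f, IsRiemannCompetitor U p f → ‖deriv f p‖ ≤ C := by
  obtain ⟨r, hr, hrU⟩ := Metric.isOpen_iff.1 hU p hp
  refine ⟨1 / r, fun f hf => Complex.norm_deriv_le_div_of_mapsTo_ball
    (hf.differentiableOn.mono hrU) (fun z hz => ?_) hr⟩
  rw [hf.apply_eq_zero]
  exact ball_subset_closedBall (hf.mapsTo (hrU hz))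

theorem not_eqOn_const_of_deriv_ne_zero {g : ℂ → ℂ} (hU : IsOpen U) (hp : p ∈ U)
    (hd : deriv g p ≠ 0) (y : ℂ) : ¬ EqOn g (fun _ => y) U := fun h => hd <| by
  rw [(h.eventuallyEq_of_mem (hU.mem_nhds hp)).deriv_eq, deriv_const]

/-- A locally uniform limit of competitors is a competitor unless its derivative at the base point
is zero. -/
theorem IsRiemannCompetitor.of_tendstoLocallyUniformlyOn {ι : Type*} {l : Filter ι} [l.NeBot]
    (hU : IsOpen U) (hUc : IsPreconnected U) (hp : p ∈ U) {F : ι → ℂ → ℂ} {g : ℂ → ℂ}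
    (hF : ∀ i, IsRiemannCompetitor U p (F i)) (hlim : TendstoLocallyUniformlyOn F g l U)
    (hgp : deriv g p ≠ 0) : IsRiemannCompetitor U p g := by
  have hpt : ∀ z ∈ U, Tendsto (fun i => F i z) l (𝓝 (g z)) := fun z hz => hlim.tendsto_at hz
  have hg : DifferentiableOn ℂ g U :=
    hlim.differentiableOn (Eventually.of_forall fun i => (hF i).differentiableOn) hU
  have hg0 : g p = 0 :=
    tendsto_nhds_unique (hpt p hp) (by simp [(hF _).apply_eq_zero])
  have hg1 : ∀ z ∈ U, ‖g z‖ ≤ 1 := fun z hz =>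
    le_of_tendsto (hpt z hz).norm (Eventually.of_forall fun i =>
      (mem_ball_zero_iff.1 ((hF i).mapsTo hz)).le)
  refine ⟨hg, fun z hz => mem_ball_zero_iff.2 ((hg1 z hz).lt_of_ne fun hz1 => ?_),
    fun a ha b hb hab => ?_, fun z hz hz0 => ?_, hg0⟩
  · refine not_eqOn_const_of_deriv_ne_zero hU hp hgp _
      (Complex.eqOn_of_isPreconnected_of_isMaxOn_norm hUc hU hg hz fun w hw => ?_)
    simpa [hz1] using hg1 w hw
  · by_contra hne
    -- By injectivity `F i - F i a` has no zero on `U \ {a}`, so Hurwitz excludes a second point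
    -- where `g` equals `g a`.
    have hlim' : TendstoLocallyUniformlyOn (fun i z => F i z - F i a) (fun z => g z - g a) l U := by
      refine hlim.sub fun u hu z hz => ⟨univ, univ_mem, ?_⟩
      filter_upwards [(Uniform.tendsto_nhds_right.1 (hpt a ha)) hu] with i hi y _ using hi
    have := eqOn_zero_of_tendstoLocallyUniformlyOn hU hUc (hU.inter isOpen_compl_singleton)
      (inter_subset_left (t := {a}ᶜ)) (fun i => (hF i).differentiableOn.sub_const _)
      (fun i z hz h => hz.2 ((hF i).injOn hz.1 ha (sub_eq_zero.1 h))) hlim'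
      (c := b) ⟨hb, Ne.symm hne⟩ (sub_eq_zero.2 hab.symm)
    exact not_eqOn_const_of_deriv_ne_zero hU hp hgp (g a) fun z hz => sub_eq_zero.1 (this hz)
  · exact hgp (eqOn_zero_of_tendstoLocallyUniformlyOn hU hUc hU subset_rfl
      (fun i => (hF i).differentiableOn.deriv hU) (fun i => (hF i).deriv_ne_zero)
      (hlim.deriv (Eventually.of_forall fun i => (hF i).differentiableOn) hU) hz hz0 hp)

/-- A maximising sequence has a limit whose derivative at `p` attains the supremum; this is positive
because some competitor exists, so the limit is a competitor. -/
theorem exists_isRiemannCompetitor_maximal (hU : IsOpen U) (hUc : IsPreconnected U)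
    (hUb : Bornology.IsBounded U) (hp : p ∈ U) :
    ∃ f, IsRiemannCompetitor U p f ∧
      ∀ h, IsRiemannCompetitor U p h → ‖deriv h p‖ ≤ ‖deriv f p‖ := by
  obtain ⟨f₀, hf₀⟩ := exists_isRiemannCompetitor (p := p) hUb
  obtain ⟨C, hC⟩ := exists_norm_deriv_le_of_mapsTo_unitBall hU hp
  set A : Set ℝ := {t | ∃ f, IsRiemannCompetitor U p f ∧ ‖deriv f p‖ = t}
  have hA : A.Nonempty := ⟨_, f₀, hf₀, rfl⟩
  have hAb : BddAbove A := ⟨C, by rintro _ ⟨f, hf, rfl⟩; exact hC f hf⟩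
  obtain ⟨u, -, hu, huA⟩ := exists_seq_tendsto_sSup hA hAb
  choose F hF hFu using huA
  obtain ⟨g, hg⟩ := exists_tendstoLocallyUniformlyOn_of_norm_le_one hU (hyperfilter ℕ)
    (fun i => (hF i).differentiableOn) fun i z hz => (mem_ball_zero_iff.1 ((hF i).mapsTo hz)).le
  have hd : Tendsto (fun i => ‖deriv (F i) p‖) (hyperfilter ℕ : Filter ℕ) (𝓝 ‖deriv g p‖) :=
    ((hg.deriv (Eventually.of_forall fun i => (hF i).differentiableOn) hU).tendsto_at hp).norm
  have hgs : ‖deriv g p‖ = sSup A := by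
    refine tendsto_nhds_unique hd ?_
    simp_rw [hFu]
    exact hu.mono_left Nat.hyperfilter_le_atTop
  have hle : ∀ h, IsRiemannCompetitor U p h → ‖deriv h p‖ ≤ ‖deriv g p‖ := fun h hh => by
    rw [hgs]; exact le_csSup hAb ⟨h, hh, rfl⟩
  have hpos : deriv g p ≠ 0 :=
    norm_pos_iff.1 ((norm_pos_iff.2 (hf₀.deriv_ne_zero p hp)).trans_le (hle f₀ hf₀))
  exact ⟨g, .of_tendstoLocallyUniformlyOn hU hUc hp hF hg hpos, hle⟩

/-- A competitor that omits a value of the unit disc is not extremal. -/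
theorem IsRiemannCompetitor.exists_norm_deriv_lt (hU : IsOpen U) (hUs : IsSimplyConnected U)
    (hp : p ∈ U) {f : ℂ → ℂ} (hf : IsRiemannCompetitor U p f) {w : ℂ} (hw : w ∈ ball (0 : ℂ) 1)
    (hwf : w ∉ f '' U) : ∃ h, IsRiemannCompetitor U p h ∧ ‖deriv f p‖ < ‖deriv h p‖ := by
  have hw0 : w ≠ 0 := fun h => hwf ⟨p, hp, by rw [hf.apply_eq_zero, h]⟩
  have hfd : ∀ z ∈ U, HasDerivAt f (deriv f z) z := fun z hz =>
    (hf.differentiableOn.differentiableAt (hU.mem_nhds hz)).hasDerivAt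
  have hk : ∀ z ∈ U, HasDerivAt (fun z => moebius w (f z))
      ((1 - conj w * w) / (1 - conj w * f z) ^ 2 * deriv f z) z := fun z hz =>
    (hasDerivAt_moebius hw (hf.mapsTo hz)).comp z (hfd z hz)
  have hk0 : ∀ z ∈ U, moebius w (f z) ≠ 0 := fun z hz h =>
    hwf ⟨z, hz, (moebius_eq_zero_iff hw (hf.mapsTo hz)).1 h⟩
  -- Koebe's trick: `moebius w ∘ f` has no zeros on the simply connected `U`, hence a square root
  -- `s`. Recentring `s` at `p` gives the better competitor.
  obtain ⟨s, hsc, hs⟩ := Complex.exists_continuousOn_pow_eq hUs hU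
    (g := fun z => moebius w (f z)) (fun z hz => (hk z hz).continuousAt.continuousWithinAt)
    (by rintro ⟨z, hz, h⟩; exact hk0 z hz h) two_ne_zero
  have hs0 : ∀ z ∈ U, s z ≠ 0 := fun z hz h => hk0 z hz (by simp [← hs z, h])
  -- So far `s` is only continuous; near `z` it coincides with a local inverse of squaring composed
  -- with `moebius w ∘ f`.
  have hsd : ∀ z ∈ U, HasDerivAt s
      ((2 * s z)⁻¹ * ((1 - conj w * w) / (1 - conj w * f z) ^ 2 * deriv f z)) z := fun z hz => by
    have h2 : (2 : ℂ) * s z ≠ 0 := mul_ne_zero two_ne_zero (hs0 z hz)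
    have hpow : HasStrictDerivAt (fun y : ℂ => y ^ 2) (2 * s z) (s z) := by
      simpa using hasStrictDerivAt_pow 2 (s z)
    have hinv := hpow.to_localInverse h2
    have hloc : ∀ᶠ y in 𝓝 z, hpow.localInverse _ _ _ h2 (moebius w (f y)) = s y := by
      have := (hsc.continuousAt (hU.mem_nhds hz)).eventually
        (hpow.hasStrictFDerivAt_equiv h2).eventually_left_inverse
      filter_upwards [this] with y hy
      rw [← hs y]
      exact hy
    have hinv' : HasDerivAt (hpow.localInverse _ _ _ h2) (2 * s z)⁻¹ (moebius w (f z)) := by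
      rw [← hs z]; exact hinv.hasDerivAt
    exact (hinv'.comp z (hk z hz)).congr_of_eventuallyEq (hloc.mono fun y hy => hy.symm)
  have hs1 : MapsTo s U (ball 0 1) := fun z hz => by
    have := moebius_mapsTo hw (hf.mapsTo hz)
    rw [mem_ball_zero_iff] at this ⊢
    have h2 : ‖s z‖ ^ 2 < 1 := by rw [← norm_pow, hs z]; exact this
    exact (sq_lt_one_iff₀ (norm_nonneg _)).1 h2
  have ha : s p ∈ ball (0 : ℂ) 1 := hs1 hp
  have hh : ∀ z ∈ U, HasDerivAt (fun z => moebius (s p) (s z))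
      ((1 - conj (s p) * s p) / (1 - conj (s p) * s z) ^ 2 * ((2 * s z)⁻¹ *
        ((1 - conj w * w) / (1 - conj w * f z) ^ 2 * deriv f z))) z := fun z hz =>
    (hasDerivAt_moebius ha (hs1 hz)).comp z (hsd z hz)
  refine ⟨fun z => moebius (s p) (s z),
    ⟨fun z hz => (hh z hz).differentiableAt.differentiableWithinAt,
      fun z hz => moebius_mapsTo ha (hs1 hz), fun y hy z hz h => ?_, fun z hz => ?_, by simp⟩, ?_⟩
  · have h1 := moebius_injOn ha (hs1 hy) (hs1 hz) h
    refine hf.injOn hy hz (moebius_injOn hw (hf.mapsTo hy) (hf.mapsTo hz) ?_)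
    rw [← hs y, ← hs z, h1]
  · rw [(hh z hz).deriv]
    have h1 := moebius_denom_ne_zero ha ha
    have h2 := moebius_denom_ne_zero ha (hs1 hz)
    have h3 := moebius_denom_ne_zero hw hw
    have h4 := moebius_denom_ne_zero hw (hf.mapsTo hz)
    have h5 := hs0 z hz
    have h6 := hf.deriv_ne_zero z hz
    exact mul_ne_zero (div_ne_zero h1 (pow_ne_zero _ h2)) (mul_ne_zero
      (inv_ne_zero (mul_ne_zero two_ne_zero h5)) (mul_ne_zero (div_ne_zero h3 (pow_ne_zero _ h4)) h6))
  · have hnorm : ∀ a : ℂ, a ∈ ball (0 : ℂ) 1 → ‖1 - conj a * a‖ = 1 - ‖a‖ ^ 2 := fun a ha => by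
      rw [Complex.conj_mul', ← Complex.ofReal_pow, ← Complex.ofReal_one, ← Complex.ofReal_sub,
        Complex.norm_real, Real.norm_of_nonneg]
      nlinarith [mem_ball_zero_iff.1 ha, norm_nonneg a]
    have hsq : ‖s p‖ ^ 2 = ‖w‖ := by
      rw [← norm_pow, hs p, hf.apply_eq_zero, moebius_zero_right, norm_neg]
    have ht0 : 0 < ‖s p‖ := norm_pos_iff.2 (hs0 p hp)
    have ht1 : ‖s p‖ < 1 := mem_ball_zero_iff.1 ha
    have hfp : 0 < ‖deriv f p‖ := norm_pos_iff.2 (hf.deriv_ne_zero p hp)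
    rw [(hh p hp).deriv, hf.apply_eq_zero]
    simp only [norm_mul, norm_div, norm_inv, norm_pow, hnorm _ ha, hnorm _ hw, mul_zero, sub_zero,
      one_pow, div_one, Complex.norm_ofNat]
    rw [← hsq]
    generalize ‖s p‖ = t at *
    have h1 : 1 - t ^ 2 ≠ 0 := by nlinarith
    -- With `t = ‖s p‖` and `t ^ 2 = ‖w‖`, the derivative gains the factor `(1 + t ^ 2) / (2 * t)`,
    -- which exceeds 1 as `(1 - t) ^ 2 > 0`.
    have e : (1 - t ^ 2) / (1 - t ^ 2) ^ 2 * ((2 * t)⁻¹ * ((1 - (t ^ 2) ^ 2) * ‖deriv f p‖)) =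
        (1 + t ^ 2) / (2 * t) * ‖deriv f p‖ := by
      field_simp
      ring
    rw [e]
    refine lt_mul_of_one_lt_left hfp ?_
    rw [one_lt_div (by positivity)]
    nlinarith [sq_pos_of_pos (sub_pos.2 ht1)]

/-- **Riemann mapping theorem** for bounded simply connected domains, with a base point. -/
theorem exists_riemannMap (hU : IsOpen U) (hUs : IsSimplyConnected U)
    (hUb : Bornology.IsBounded U) (hp : p ∈ U) :
    ∃ f F : ℂ → ℂ, DifferentiableOn ℂ f U ∧ BijOn f U (ball 0 1) ∧
      DifferentiableOn ℂ F (ball 0 1) ∧ InvOn F f U (ball 0 1) ∧ F 0 = p := by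
  obtain ⟨f, hf, hmax⟩ := exists_isRiemannCompetitor_maximal hU
    hUs.isPathConnected.isConnected.isPreconnected hUb hp
  have hsurj : SurjOn f U (ball 0 1) := fun w hw => by
    by_contra hwf
    obtain ⟨h, hh, hlt⟩ := hf.exists_norm_deriv_lt hU hUs hp hw hwf
    exact (hmax h hh).not_gt hlt
  have hbij : BijOn f U (ball 0 1) := ⟨hf.mapsTo, hf.injOn, hsurj⟩
  have hinv := hbij.invOn_invFunOn
  refine ⟨f, Function.invFunOn f U, hf.differentiableOn, hbij, fun w hw => ?_, hinv, ?_⟩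
  · obtain ⟨z, hz, rfl⟩ := hsurj hw
    have hst := (hf.differentiableOn.analyticAt (hU.mem_nhds hz)).hasStrictDerivAt
    exact (hst.to_local_left_inverse (hf.deriv_ne_zero z hz) (eventually_of_mem (hU.mem_nhds hz)
      fun y hy => hinv.1 hy)).hasDerivAt.differentiableAt.differentiableWithinAt
  · rw [← hf.apply_eq_zero]; exact hinv.1 hp

/-! ### The Lelong functional -/

theorem lelongFunctional_eq_of_unique {n : ℕ} (m : ℝ) {p : Fin n → ℂ} {f : ℂ → Fin n → ℂ} {a : ℂ}
    (ha : a ∈ unitDisc) (hf : ∀ w ∈ unitDisc, f w = p ↔ w = a) (hmult : discMultiplicity f a = 1) :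
    lelongFunctional (Set.indicator {p} fun _ => m) f = (m : EReal) * ENNReal.log ‖a‖ₑ := by
  rw [lelongFunctional, tsum_eq_single (⟨a, ha⟩ : unitDisc)]
  · have : f a = p := (hf a ha).2 rfl
    simp [this, hmult]
  · intro b hb
    have : f b ≠ p := fun h => hb (Subtype.ext ((hf b b.2).1 h))
    simp [this]

theorem le_lelongFunctional_of_forall_sum {n : ℕ} {α : (Fin n → ℂ) → ℝ} {f : ℂ → Fin n → ℂ}
    {C : EReal} (h : ∀ S : Finset unitDisc, C ≤ ∑ a ∈ S, (α (f a) : EReal) *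
      (((discMultiplicity f a : ℕ∞) : ℝ≥0∞) : EReal) * ENNReal.log ‖(a : ℂ)‖ₑ) :
    C ≤ lelongFunctional α f := by
  rw [lelongFunctional]
  by_cases hs : Summable fun a : unitDisc => (α (f a) : EReal) *
      (((discMultiplicity f a : ℕ∞) : ℝ≥0∞) : EReal) * ENNReal.log ‖(a : ℂ)‖ₑ
  · exact ge_of_tendsto hs.hasSum (Eventually.of_forall h)
  -- The default value 0 of a divergent `tsum` is harmless: the empty partial sum already gives `C ≤
  -- 0`.
  · rw [tsum_eq_zero_of_not_summable hs]
    simpa using h ∅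

theorem coe_finset_sum {ι : Type*} (S : Finset ι) (u : ι → ℝ) :
    ((∑ a ∈ S, u a : ℝ) : EReal) = ∑ a ∈ S, (u a : EReal) := by
  classical
  induction S using Finset.induction_on with
  | empty => simp
  | insert a S ha ih => rw [Finset.sum_insert ha, Finset.sum_insert ha, EReal.coe_add, ih]

/-- A coordinate vanishes at least to the order of the whole vector, and composing with `T`, of
order at least 1, multiplies the order. -/
theorem discMultiplicity_le_analyticOrderAt_comp {n : ℕ} {g : ℂ → Fin n → ℂ} {a : ℂ} (j : Fin n)
    (hg : AnalyticAt ℂ g a) {T : ℂ → ℂ} (hT : AnalyticAt ℂ T (g a j)) (hT0 : T (g a j) = 0) :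
    discMultiplicity g a ≤ analyticOrderAt (fun z => T (g z j)) a := by
  have hgj : AnalyticAt ℂ (fun z => g z j) a :=
    ((ContinuousLinearMap.proj (R := ℂ) (φ := fun _ : Fin n => ℂ) j).analyticAt _).comp hg
  have hle : discMultiplicity g a ≤ analyticOrderAt (fun z => g z j - g a j) a := by
    refine ENat.forall_natCast_le_iff_le.1 fun k hk => ?_
    rw [discMultiplicity, natCast_le_analyticOrderAt (hg.fun_sub analyticAt_const)] at hk
    obtain ⟨G, hG, hGe⟩ := hk
    rw [natCast_le_analyticOrderAt (hgj.fun_sub analyticAt_const)]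
    refine ⟨fun z => G z j,
      ((ContinuousLinearMap.proj (R := ℂ) (φ := fun _ : Fin n => ℂ) j).analyticAt _).comp hG, ?_⟩
    filter_upwards [hGe] with z hz
    simpa using congrFun hz j
  have hcomp : analyticOrderAt (fun z => T (g z j)) a =
      analyticOrderAt T (g a j) * analyticOrderAt (fun z => g z j - g a j) a :=
    AnalyticAt.analyticOrderAt_comp (f := T) (g := fun z => g z j) hT hgj
  rw [hcomp]
  have h1 : 1 ≤ analyticOrderAt T (g a j) :=
    Order.one_le_iff_pos.2 (pos_iff_ne_zero.2 (hT.analyticOrderAt_ne_zero.2 hT0))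
  exact hle.trans (le_mul_of_one_le_left (zero_le) h1)

/-- The bound from below for the Lelong functional that a bounded holomorphic function on one of
the factors gives. -/
theorem mul_log_le_lelongFunctional {n : ℕ} {X : Fin n → Set ℂ} {p x : Fin n → ℂ} {m : ℝ}
    (hm : 0 ≤ m) {g : ℂ → Fin n → ℂ} (hg : IsAnalyticDisc (Set.univ.pi X) g) (hgx : g 0 = x)
    (j : Fin n) (hXj : IsOpen (X j)) {f : ℂ → ℂ} (hf : DifferentiableOn ℂ f (X j))
    (hf1 : MapsTo f (X j) (ball 0 1)) (hfx : f (x j) = 0) (hpj : p j ∈ X j) (hfp : f (p j) ≠ 0) :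
    (m : EReal) * ENNReal.log ‖f (p j)‖ₑ ≤
      lelongFunctional (Set.indicator {p} fun _ => m) g := by
  classical
  obtain ⟨hgd, hgm⟩ := hg
  have hgmj : ∀ z ∈ ball (0 : ℂ) 1, g z j ∈ X j := fun z hz => hgm hz j (mem_univ j)
  have hq : f (p j) ∈ ball (0 : ℂ) 1 := hf1 hpj
  set T : ℂ → ℂ := fun y => moebius (f (p j)) (f y)
  have hT : DifferentiableOn ℂ T (X j) := (differentiableOn_moebius hq).comp hf hf1
  have hT0 : T (p j) = 0 := moebius_self _
  set b : ℂ → ℂ := fun z => T (g z j)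
  have hb : DifferentiableOn ℂ b (ball 0 1) :=
    hT.comp (fun z hz => (differentiableWithinAt_pi.1 (hgd z hz)) j) hgmj
  have hb1 : ∀ z ∈ ball (0 : ℂ) 1, ‖b z‖ ≤ 1 := fun z hz =>
    (mem_ball_zero_iff.1 (moebius_mapsTo hq (hf1 (hgmj z hz)))).le
  have hb0 : b 0 = -f (p j) := by simp [b, T, hgx, hfx]
  have hord : ∀ a ∈ ball (0 : ℂ) 1, g a = p → discMultiplicity g a ≤ analyticOrderAt b a :=
    fun a ha hap => discMultiplicity_le_analyticOrderAt_comp j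
      (analyticAt_of_differentiableOn_unitBall hgd ha)
      (hT.analyticAt (hXj.mem_nhds (hgmj a ha))) (by rw [hap]; exact hT0)
  -- As `b 0 ≠ 0`, the identity theorem makes all orders finite, and hence also the multiplicities
  -- of `g` over `p`.
  have htop : ∀ a ∈ ball (0 : ℂ) 1, analyticOrderAt b a ≠ ⊤ := fun a ha => by
    have h0 : (0 : ℂ) ∈ ball (0 : ℂ) 1 := mem_ball_self one_pos
    refine (hb.analyticOnNhd isOpen_ball).analyticOrderAt_ne_top_of_isPreconnected
      (convex_ball _ _).isPreconnected h0 ha ?_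
    rw [(hb.analyticAt (isOpen_ball.mem_nhds h0)).analyticOrderAt_eq_zero.2
      (by rw [hb0]; exact neg_ne_zero.2 hfp)]
    exact ENat.zero_ne_top
  set k : ℂ → ℕ := fun a => if g a = p then (discMultiplicity g a).toNat else 0
  have hterm : ∀ a : unitDisc, ((Set.indicator {p} (fun _ => m) (g a) : ℝ) : EReal) *
      (((discMultiplicity g a : ℕ∞) : ℝ≥0∞) : EReal) * ENNReal.log ‖(a : ℂ)‖ₑ =
      ((m * (k a * Real.log ‖(a : ℂ)‖) : ℝ) : EReal) := fun a => by
    by_cases hap : g a = p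
    · have hfin : discMultiplicity g a ≠ ⊤ := ne_top_of_le_ne_top (htop a a.2) (hord a a.2 hap)
      -- The origin does not lie over `p`, so every logarithm that counts is finite and the sum can
      -- be handled in `ℝ`.
      have ha0 : ‖(a : ℂ)‖ ≠ 0 := fun h => hfp <| by
        rw [← hap, norm_eq_zero.1 h, hgx, hfx]
      have hlog : ENNReal.log ‖(a : ℂ)‖ₑ = (Real.log ‖(a : ℂ)‖ : ℝ) := by
        rw [← ofReal_norm, ENNReal.log_ofReal_of_pos ((norm_nonneg _).lt_of_ne' ha0)]
      obtain ⟨N, hN⟩ := ENat.ne_top_iff_exists.1 hfin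
      simp only [k, hap, if_true, hlog, ← hN, Set.indicator_of_mem (Set.mem_singleton p)]
      simp only [ENat.toNat_natCast, ENat.toENNReal_coe, EReal.coe_mul, mul_assoc]
      rfl
    · simp [k, hap]
  refine le_lelongFunctional_of_forall_sum fun S => ?_
  have hprod := norm_apply_zero_le_prod_norm_zeros (S.map (Function.Embedding.subtype _)) k
    (fun a ha => by
      obtain ⟨c, -, rfl⟩ := Finset.mem_map.1 ha
      exact c.2) hb hb1 (fun a ha => by
      obtain ⟨c, -, rfl⟩ := Finset.mem_map.1 ha
      by_cases hap : g c = p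
      · simpa [k, hap] using (ENat.natCast_toNat_le_self _).trans (hord c c.2 hap)
      · simp [k, hap])
  rw [Finset.prod_map, hb0, norm_neg] at hprod
  have hfpos : 0 < ‖f (p j)‖ := norm_pos_iff.2 hfp
  have hne : ∀ a ∈ S, ‖(a : ℂ)‖ ^ k a ≠ 0 := fun a haS h => by
    have : (∏ c ∈ S, ‖(Function.Embedding.subtype (· ∈ unitDisc) c : ℂ)‖ ^
      k (Function.Embedding.subtype (· ∈ unitDisc) c)) = 0 := Finset.prod_eq_zero haS h
    linarith
  have hlog := Real.log_le_log hfpos hprod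
  simp only [Function.Embedding.coe_subtype] at hlog
  rw [Real.log_prod hne] at hlog
  simp only [Real.log_pow] at hlog
  have hlhs : (m : EReal) * ENNReal.log ‖f (p j)‖ₑ = ((m * Real.log ‖f (p j)‖ : ℝ) : EReal) := by
    rw [← ofReal_norm, ENNReal.log_ofReal_of_pos hfpos, EReal.coe_mul]
  rw [Finset.sum_congr rfl fun a _ => hterm a, hlhs, ← coe_finset_sum, EReal.coe_le_coe_iff,
    ← Finset.mul_sum]
  exact mul_le_mul_of_nonneg_left hlog hm

/-- By the chain rule, a differentiable left inverse through one coordinate forces `deriv f a ≠ 0`.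
-/
theorem discMultiplicity_eq_one_of_leftInverse {n : ℕ} {f : ℂ → Fin n → ℂ} {a : ℂ} (j : Fin n)
    (hf : AnalyticAt ℂ f a) {G : ℂ → ℂ} (hG : DifferentiableAt ℂ G (f a j))
    (hGf : ∀ᶠ w in 𝓝 a, G (f w j) = w) : discMultiplicity f a = 1 := by
  refine hf.analyticOrderAt_sub_eq_one_of_deriv_ne_zero fun h0 => ?_
  have hfj : HasDerivAt (fun w => f w j) (deriv f a j) a :=
    (hasDerivAt_pi.1 hf.differentiableAt.hasDerivAt) j
  have h1 : HasDerivAt (fun w => G (f w j)) (deriv G (f a j) * deriv f a j) a :=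
    hG.hasDerivAt.comp a hfj
  have h2 := h1.unique ((hasDerivAt_id a).congr_of_eventuallyEq hGf)
  simp [h0] at h2

theorem mul_mem_unitBall {c w : ℂ} (hc : ‖c‖ ≤ 1) (hw : w ∈ ball (0 : ℂ) 1) :
    c * w ∈ ball (0 : ℂ) 1 := by
  rw [mem_ball_zero_iff] at hw ⊢
  rw [norm_mul]
  exact (mul_le_of_le_one_left (norm_nonneg _) hc).trans_lt hw

theorem exists_dilation_factors {n : ℕ} (z : Fin n → ℂ) (j : Fin n) (hj : ∀ i, ‖z i‖ ≤ ‖z j‖) :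
    ∃ c : Fin n → ℂ, c j = 1 ∧ ∀ i, ‖c i‖ ≤ 1 ∧ c i * z j = z i := by
  by_cases h0 : z j = 0
  · refine ⟨fun _ => 1, rfl, fun i => ⟨norm_one.le, ?_⟩⟩
    have := hj i
    rw [h0, norm_zero, norm_le_zero_iff] at this
    rw [this, h0, mul_zero]
  · refine ⟨fun i => z i / z j, div_self h0, fun i => ⟨?_, div_mul_cancel₀ _ h0⟩⟩
    rw [norm_div, div_le_one (norm_pos_iff.2 h0)]
    exact hj i

theorem isBiholomorphicOn_id : IsBiholomorphicOn id unitDisc unitDisc :=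
  ⟨differentiableOn_id, bijOn_id _⟩

end LelongDisc

theorem theorem8 {n : ℕ} (hn : 1 ≤ n) (X : Fin n → Set ℂ)
    (hX : ∀ i, LelongDisc.IsJordanDomain (X i))
    (p : Fin n → ℂ) (hp : p ∈ Set.univ.pi X) (m : ℝ) (hm : 0 ≤ m)
    (x : Fin n → ℂ) (hx : x ∈ Set.univ.pi X) :
    ∃ f : ℂ → Fin n → ℂ,
      LelongDisc.IsAnalyticDisc (Set.univ.pi X) f ∧ f 0 = x ∧
      LelongDisc.lelongEnvelope (Set.univ.pi X) (Set.indicator {p} fun _ => m) x =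
        LelongDisc.lelongFunctional (Set.indicator {p} fun _ => m) f ∧
      ∃ (F ψ : Fin n → ℂ → ℂ) (z : Fin n → ℂ) (c : Fin n → ℂ) (j : Fin n),
        (∀ i, LelongDisc.IsBiholomorphicOn (F i) LelongDisc.unitDisc (X i)) ∧
        (∀ i, LelongDisc.IsBiholomorphicOn (ψ i) LelongDisc.unitDisc LelongDisc.unitDisc) ∧
        (∀ i, F i (ψ i 0) = x i) ∧
        (∀ i, z i ∈ LelongDisc.unitDisc ∧ F i (ψ i (z i)) = p i) ∧
        (∀ i, ‖z i‖ ≤ ‖z j‖) ∧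
        c j = 1 ∧ (∀ i, ‖c i‖ ≤ 1 ∧ c i * z j = z i) ∧
        ∀ w ∈ LelongDisc.unitDisc, ∀ i, f w i = F i (ψ i (c i * w)) := by
  have hpX : ∀ i, p i ∈ X i := fun i => hp i (Set.mem_univ i)
  have hxX : ∀ i, x i ∈ X i := fun i => hx i (Set.mem_univ i)
  choose G F hGd hG hFd hinv hF0 using fun i => LelongDisc.exists_riemannMap (hX i).isOpen
    (hX i).isSimplyConnected (hX i).isBounded (hxX i)
  have hF : ∀ i, Set.BijOn (F i) (Metric.ball 0 1) (X i) := fun i => (hG i).symm (hinv i).symm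
  have : Nonempty (Fin n) := ⟨⟨0, hn⟩⟩
  obtain ⟨j, hj⟩ := Finite.exists_max fun i => ‖G i (p i)‖
  have hz : ∀ i, G i (p i) ∈ Metric.ball (0 : ℂ) 1 := fun i => (hG i).mapsTo (hpX i)
  obtain ⟨c, hcj, hc⟩ := LelongDisc.exists_dilation_factors (fun i => G i (p i)) j hj
  have hcw : ∀ i, ∀ w ∈ Metric.ball (0 : ℂ) 1, c i * w ∈ Metric.ball (0 : ℂ) 1 := fun i w hw =>
    LelongDisc.mul_mem_unitBall (hc i).1 hw
  set f : ℂ → Fin n → ℂ := fun w i => F i (c i * w)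
  have hfd : DifferentiableOn ℂ f (Metric.ball 0 1) := differentiableOn_pi.2 fun i =>
    (hFd i).comp (differentiableOn_id.const_mul (c i)) (hcw i)
  have hfX : LelongDisc.IsAnalyticDisc (Set.univ.pi X) f :=
    ⟨hfd, fun w hw i _ => (hF i).mapsTo (hcw i w hw)⟩
  have hfj : ∀ w ∈ Metric.ball (0 : ℂ) 1, G j (f w j) = w := fun w hw => by
    simp only [f, hcj, one_mul]
    exact (hinv j).2 hw
  have hfp : ∀ w ∈ LelongDisc.unitDisc, f w = p ↔ w = G j (p j) := fun w hw => by
    refine ⟨fun h => by rw [← hfj w hw, h], ?_⟩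
    rintro rfl
    funext i
    simp only [f, (hc i).2]
    exact (hinv i).1 (hpX i)
  have hfx : f 0 = x := by
    funext i
    simp [f, hF0]
  have hmult : LelongDisc.discMultiplicity f (G j (p j)) = 1 := by
    refine LelongDisc.discMultiplicity_eq_one_of_leftInverse j
      (LelongDisc.analyticAt_of_differentiableOn_unitBall hfd (hz j)) (G := G j) ?_
      (Filter.eventually_of_mem (Metric.isOpen_ball.mem_nhds (hz j)) hfj)
    exact (hGd j).differentiableAt
      ((hX j).isOpen.mem_nhds (hfX.2 (hz j) j (Set.mem_univ j)))
  have hGx : G j (x j) = 0 := by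
    rw [← hF0 j]; exact (hinv j).2 (Metric.mem_ball_self one_pos)
  have hval := LelongDisc.lelongFunctional_eq_of_unique m (hz j) hfp hmult
  -- Since `F i 0 = x i` already, every `ψ i` can be the identity.
  refine ⟨f, hfX, hfx, le_antisymm (iInf_le_of_le f (iInf₂_le hfX hfx))
    (le_iInf fun g => le_iInf₂ fun hg hgx => ?_), F, fun _ => id, fun i => G i (p i), c, j,
    fun i => ⟨hFd i, hF i⟩, fun _ => LelongDisc.isBiholomorphicOn_id, hF0,
    fun i => ⟨hz i, (hinv i).1 (hpX i)⟩, hj, hcj, hc, fun w _ i => rfl⟩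
  rw [hval]
  -- When `q j = 0`, the value is `m * ⊥`: it is `⊥` for `m > 0`, and for `m = 0` both sides vanish.
  by_cases hzj : G j (p j) = 0
  · rcases hm.eq_or_lt with rfl | hm0
    · simp [LelongDisc.lelongFunctional]
    · simp [hzj, EReal.coe_mul_bot_of_pos hm0]
  · exact LelongDisc.mul_log_le_lelongFunctional hm hg hgx j (hX j).isOpen (hGd j)
      (hG j).mapsTo hGx (hpX j) hzj
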